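/- **Setting.** Let $k,r\ge 1$ and let $\|\cdot\|$ be the Euclidean norm on $\mathbb R^r$. A Euclidean $k$-means instance is a finite set $P\subset\mathbb R^r$. A $k$-clustering $\mathcal O$ of it is a labeling $f_{\mathcal O}:P\to[k]$ together with centers $o_1,\dots,o_k\in\mathbb R^r$, where $o_i$ minimizes $q\mapsto\sum_{p\in O_i}\|p-q\|^2$ over $q \in \mathbb R^r$, with $O_i=f_{\mathcal O}^{-1}(i)$. Its cost is $\sum_i\sum_{p\in O_i}\|p-o_i\|^2$, and it is optimal if no $k$-clustering of $P$ has smaller cost. The instance has no boundary points if in every optimal $k$-clustering, $p\in O_i$ implies $\|p-o_i\|<\|p-o_j\|$ for all $j\ne i$. Let $K$ be the family of instances without boundary points. A learning algorithm receives an instance $P$ and a finite list of labeled sample points $(s,f_{\mathcal O}(s))$, $s\in S$, and outputs $h:P\to[k]$. It learns $K$ with sample complexity $m(\epsilon,\delta)$ if for all $\epsilon,\delta\in(0,1)$, all $P\in K$, all optimal $k$-clusterings $\mathcal O$ of $P$, all nonempty $T\subseteq P$ and all $n\ge m(\epsilon,\delta)$: when $S$ consists of $n$ independent uniform samples from $T$,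 then with probability at least $1-\delta$ we have $|\{p\in T:h(p)=f_{\mathcal O}(p)\}|\ge(1-\epsilon)|T|$. It has zero sample error on $K$ if always $h(s)=f_{\mathcal O}(s)$ for all $s\in S$, and is non-inventive on $K$ if, whenever $S$ is nonempty, each value of $h$ equals $f_{\mathcal O}(s)$ for some $s\in S$. Let $\mathcal H_b$ be the class of classifiers $x\mapsto +1$ if $\langle w,x\rangle+b\ge0$, and $-1$ otherwise, with $w\in\mathbb R^r\setminus\{0\}$ and $b\in\mathbb R$. An ERM algorithm for a hypothesis class maps every finite labeled sample to a member of the class that minimizes the number of errors on the sample. Given an ERM algorithm $\mathcal B$ for $\mathcal H_b$ and a rule $\operatorname{argmax}$ choosing an index of a maximal entry of a vector in $\mathbb Z^k$, the all-pairs halfspace algorithm works as follows. For $a\ne b$ in $[k]$, let $S_{a,b}$ be the list of the sample points labeled $a$ or $b$, relabeled $+1$ and $-1$ respectively. Let $g_{a,b}=1$ if $a$ but not $b$ occurs as a label in the sample, $g_{a,b}=-1$ if $b$ but not $a$ occurs, and $g_{a,b}=\mathcal B(S_{a,b})$ otherwise. Output $h(x)=\operatorname{argmax}_{a\in[k]}\sum_{b\ne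 a}g_{a,b}(x)$. **Theorem.** There is a universal constant $C>0$ such that for all $k,r\ge1$ there is a function $m$ with positive integer values, depending only on $k,r,\epsilon,\delta$ (and not on $n=|P|$), with $$m(\epsilon,\delta)\le\left\lceil C\cdot\frac{k^2r\,\log(k^2r)\,\log(k^3r/\epsilon)+\log(1/\delta)}{\epsilon}\right\rceil\qquad\text{for all }\epsilon,\delta\in(0,1),$$ such that the following holds. ERM algorithms $\mathcal B$ for $\mathcal H_b$ and argmax rules exist, and for every such $\mathcal B$ and every such rule the all-pairs halfspace algorithm learns $K$ with sample complexity $m$, has zero sample error on $K$ and is non-inventive on $K$. Moreover, on samples $(s,f_{\mathcal O}(s))_{s\in S}$ from instances $P\in K$ with an optimal clustering $\mathcal O$, it is an ERM algorithm for the class of the functions $P\to[k]$, $x\mapsto\operatorname{argmax}_{a}\sum_{b\ne a}g_{a,b}(x)$ with all $g_{a,b}\in\mathcal H_b$ (and the same argmax rule). -/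

import Mathlib

noncomputable section

/-! ### k-means instances and clusterings -/

/-- A k-means instance `(P, Q, d)`: a finite set `P` of points and a set `Q` of candidate centers,
with `d` the metric of the ambient space `X`. -/
structure KMeansInstance (X : Type*) where
  P : Finset X
  Q : Set X

/-- `cost(D, q)`: the sum of the squared distances from the points of `D` to `q`. -/
def clusterCost {X : Type*} [MetricSpace X] (D : Finset X) (q : X) : ℝ :=
  ∑ p ∈ D, dist p q ^ 2

/-- The points of `P` whose label is `i`. -/
def cluster {X : Type*} {k : ℕ} (P : Finset X) (f : P → Fin k) (i : Fin k) : Finset X :=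
  (Finset.univ.filter fun p : P => f p = i).map (Function.Embedding.subtype _)

/-- A `k`-clustering of `(P, Q, d)`: a labeling `f : P → [k]` and, for each label `i`, a center
`c i ∈ Q` minimizing `cost(C_i, q)` over `q ∈ Q`, where `C_i` is the set of points labeled `i`. -/
structure KClustering {X : Type*} [MetricSpace X] (I : KMeansInstance X) (k : ℕ) where
  label : I.P → Fin k
  center : Fin k → X
  center_mem : ∀ i, center i ∈ I.Q
  center_min : ∀ i, ∀ q ∈ I.Q,
    clusterCost (cluster I.P label i) (center i) ≤ clusterCost (cluster I.P label i) q

/-- The k-means cost of a clustering. -/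
def KClustering.cost {X : Type*} [MetricSpace X] {I : KMeansInstance X} {k : ℕ}
    (O : KClustering I k) : ℝ :=
  ∑ i, clusterCost (cluster I.P O.label i) (O.center i)

/-- The clustering attains the optimal k-means cost. -/
def KClustering.IsOptimal {X : Type*} [MetricSpace X] {I : KMeansInstance X} {k : ℕ}
    (O : KClustering I k) : Prop :=
  ∀ O' : KClustering I k, O.cost ≤ O'.cost

/-- No boundary points: in every optimal `k`-clustering, each point is strictly closer to the
center of its own cluster than to every other center. -/
def KMeansInstance.NoBoundaryPoints {X : Type*} [MetricSpace X] (I : KMeansInstance X)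
    (k : ℕ) : Prop :=
  ∀ O : KClustering I k, O.IsOptimal → ∀ (p : I.P) (j : Fin k), j ≠ O.label p →
    dist (p : X) (O.center (O.label p)) < dist (p : X) (O.center j)

/-- The Euclidean instances `(P, ℝ^r, d)` with `P` finite and without boundary points. -/
def euclideanFamily (k r : ℕ) : Set (KMeansInstance (EuclideanSpace ℝ (Fin r))) :=
  {I | I.Q = Set.univ ∧ I.NoBoundaryPoints k}

/-! ### Learning k-means clusterings -/

/-- A learning algorithm: from an instance and a list of labeled sample points it outputs a
function `P → [k]`. -/
abbrev Learner (X : Type*) (k : ℕ) : Type _ :=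
  (I : KMeansInstance X) → List (I.P × Fin k) → I.P → Fin k

/-- The sample points of `s`, each together with its label under `f`. -/
def labeled {α β : Type*} (f : α → β) (s : List α) : List (α × β) :=
  s.map fun x => (x, f x)

/-- The probability that a sequence of `n` independent uniformly distributed elements of the
finite nonempty set `T` satisfies `E`. -/
def sampleProb {α : Type*} (T : Finset α) (n : ℕ) (E : List α → Prop) : ℝ :=
  (Nat.card {x : Fin n → T // E (List.ofFn fun t => (x t : α))} : ℝ) / (T.card : ℝ) ^ n

/-- `h` agrees with `f` on at least a `1 - ε` fraction of the points of `T`. -/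
def AgreesOn {α β : Type*} [DecidableEq β] (T : Finset α) (ε : ℝ) (h f : α → β) : Prop :=
  (1 - ε) * (T.card : ℝ) ≤ ((T.filter fun p => h p = f p).card : ℝ)

/-- The algorithm `A` learns the family `K` with sample complexity `m(Q, ε, δ)`. -/
def Learner.LearnsWith {X : Type*} [MetricSpace X] {k : ℕ} (A : Learner X k)
    (K : Set (KMeansInstance X)) (m : Set X → ℝ → ℝ → ℕ) : Prop :=
  ∀ ε ∈ Set.Ioo (0 : ℝ) 1, ∀ δ ∈ Set.Ioo (0 : ℝ) 1,
    ∀ I ∈ K, ∀ O : KClustering I k, O.IsOptimal →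
      ∀ T : Finset I.P, T.Nonempty → ∀ n : ℕ, m I.Q ε δ ≤ n →
        1 - δ ≤ sampleProb T n fun s => AgreesOn T ε (A I (labeled O.label s)) O.label

/-- Zero sample error: every sampled point receives its correct label. -/
def Learner.ZeroSampleError {X : Type*} [MetricSpace X] {k : ℕ} (A : Learner X k)
    (K : Set (KMeansInstance X)) : Prop :=
  ∀ I ∈ K, ∀ O : KClustering I k, O.IsOptimal → ∀ s : List I.P,
    ∀ p ∈ s, A I (labeled O.label s) p = O.label p

/-- Non-inventive: every label in the output is the label of some sampled point. -/
def Learner.NonInventive {X : Type*} [MetricSpace X] {k : ℕ} (A : Learner X k)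
    (K : Set (KMeansInstance X)) : Prop :=
  ∀ I ∈ K, ∀ O : KClustering I k, O.IsOptimal → ∀ s : List I.P, s ≠ [] →
    ∀ x : I.P, ∃ p ∈ s, O.label p = A I (labeled O.label s) x

/-! ### Empirical risk minimization -/

/-- The fraction of the examples in `S` on which `h` errs. -/
def empiricalRisk {X Y : Type*} [DecidableEq Y] (S : List (X × Y)) (h : X → Y) : ℝ :=
  (S.countP fun z => h z.1 ≠ z.2 : ℝ) / (S.length : ℝ)

/-- `h` belongs to the class `H` and minimizes the empirical risk on `S` over `H`. -/
def IsRiskMinimizer {X Y : Type*} [DecidableEq Y] (H : Set (X → Y)) (S : List (X × Y))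
    (h : X → Y) : Prop :=
  h ∈ H ∧ ∀ h' ∈ H, empiricalRisk S h ≤ empiricalRisk S h'

/-- The learning algorithm `B` is an ERM algorithm for the class `H`. -/
def IsERM {X Y : Type*} [DecidableEq Y] (H : Set (X → Y)) (B : List (X × Y) → X → Y) : Prop :=
  ∀ S, IsRiskMinimizer H S (B S)

/-! ### The all-pairs halfspace learner -/

/-- The `±1`-valued classifiers given by the sides of an (oriented) affine hyperplane in `ℝ^r`;
points of the hyperplane count to its positive side. -/
def halfspaceClass (r : ℕ) : Set (EuclideanSpace ℝ (Fin r) → ℤ) :=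
  {h | ∃ (w : EuclideanSpace ℝ (Fin r)) (b : ℝ), w ≠ 0 ∧
    h = fun x => if 0 ≤ inner ℝ w x + b then 1 else -1}

/-- A rule that selects, from a vector of scores, a label with maximal score. -/
def IsArgmaxRule {k : ℕ} (sel : (Fin k → ℤ) → Fin k) : Prop :=
  ∀ (v : Fin k → ℤ) (a : Fin k), v a ≤ v (sel v)

/-- `x ↦ argmax_a ∑_{b ≠ a} g_{a,b}(x)`, with ties broken by `sel`. -/
def allPairsVote {X : Type*} {k : ℕ} (sel : (Fin k → ℤ) → Fin k)
    (g : Fin k → Fin k → X → ℤ) (x : X) : Fin k :=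
  sel fun a => ∑ b ∈ Finset.univ.erase a, g a b x

/-- The multiclass hypotheses on the subset `P` that are all-pairs votes of halfspaces. -/
def allPairsClass {k r : ℕ} (sel : (Fin k → ℤ) → Fin k)
    (P : Finset (EuclideanSpace ℝ (Fin r))) : Set (P → Fin k) :=
  {h | ∃ g : Fin k → Fin k → EuclideanSpace ℝ (Fin r) → ℤ,
    (∀ a b, a ≠ b → g a b ∈ halfspaceClass r) ∧ h = fun p : P => allPairsVote sel g (p : EuclideanSpace ℝ (Fin r))}

/-- `S_{a,b}`: the examples labeled `a` (relabeled `1`) or `b` (relabeled `-1`). -/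
def pairSample {X : Type*} {k : ℕ} (S : List (X × Fin k)) (a b : Fin k) : List (X × ℤ) :=
  S.filterMap fun z =>
    if z.2 = a then some (z.1, 1) else if z.2 = b then some (z.1, -1) else none

/-- The label `a` occurs in the labeled sample `S`. -/
def Seen {X : Type*} {k : ℕ} (S : List (X × Fin k)) (a : Fin k) : Prop :=
  ∃ z ∈ S, z.2 = a

open Classical in
/-- The binary classifiers of the all-pairs algorithm: `g_{a,b} = B(S_{a,b})`, except that for a
seen label against an unseen one the seen label always wins. -/
def pairClassifier {X : Type*} {k : ℕ} (B : List (X × ℤ) → X → ℤ) (S : List (X × Fin k))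
    (a b : Fin k) : X → ℤ :=
  if Seen S a ∧ ¬ Seen S b then fun _ => 1
  else if ¬ Seen S a ∧ Seen S b then fun _ => -1
  else B (pairSample S a b)

/-- The all-pairs learning algorithm with binary learner `B` and tie-breaking rule `sel`. -/
def allPairsLearner {X : Type*} {k : ℕ} (B : List (X × ℤ) → X → ℤ)
    (sel : (Fin k → ℤ) → Fin k) : Learner X k :=
  fun _ S p => allPairsVote sel (pairClassifier B (S.map fun z => ((z.1 : X), z.2))) (p : X)

/-- On the samples labeled by an optimal clustering of an instance of `K`, the algorithm `A`
is an ERM algorithm for the all-pairs halfspace class on the points of the instance. -/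
def Learner.IsAllPairsERM {k r : ℕ} (A : Learner (EuclideanSpace ℝ (Fin r)) k)
    (sel : (Fin k → ℤ) → Fin k) (K : Set (KMeansInstance (EuclideanSpace ℝ (Fin r)))) : Prop :=
  ∀ I ∈ K, ∀ O : KClustering I k, O.IsOptimal → ∀ s : List I.P,
    IsRiskMinimizer (allPairsClass sel I.P) (labeled O.label s) (A I (labeled O.label s))

end

/-! ### Empirical risk -/

/-! Without boundary points, the bisector of two distinct centers separates their clusters, and two
clusters with a common center are both empty. Every pair sample is therefore realizable by a
halfspace, and ERM fits it without error. A sampled point's own label wins all its `k - 1` votes,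
while every other label loses one, so the sample error is zero and the risk minimal. Seen labels
beat unseen ones by convention, so the vote only selects seen labels.

For learning, only consistency and the size of the class matter. Radon's theorem and Sauer–Shelah
bound the halfspace traces on `M` points by `(M + 1) ^ (r + 1)`; a vote is determined by at most `k
^ 2` halfspaces, so its error sets have at most `(M + 1) ^ ((r + 1) * k ^ 2)` traces.

`card_bad_mul_le` turns this into a failure probability of at most `(2n + 1) ^ ((r + 1) * k ^ 2) /
(1 + ε) ^ n`. A sample is paired with a ghost sample and each pair gets a weight in `{0, 1, 2}`.
Averaged over random swaps, the product of the weights is at most 1 for each trace. A sample that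
misses an error set of density at least `ε` has average product at least `(1 + ε) ^ n` over the
ghost samples. `growth_le_of_le` does the final calculus. -/

theorem empiricalRisk_nonneg {X Y : Type*} [DecidableEq Y] (S : List (X × Y)) (h : X → Y) :
    0 ≤ empiricalRisk S h := by
  unfold empiricalRisk
  positivity

theorem empiricalRisk_eq_zero_iff {X Y : Type*} [DecidableEq Y] {S : List (X × Y)} {h : X → Y} :
    empiricalRisk S h = 0 ↔ ∀ z ∈ S, h z.1 = z.2 := by
  rcases S.eq_nil_or_concat with rfl | ⟨S', z, rfl⟩
  -- The empty sample has risk `0 / 0 = 0`, which matches the vacuous right-hand side.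
  · simp [empiricalRisk]
  · have hlen : ((S'.concat z).length : ℝ) ≠ 0 := by
      simp only [List.length_concat]; positivity
    rw [empiricalRisk, div_eq_zero_iff, or_iff_left hlen, Nat.cast_eq_zero, List.countP_eq_zero]
    simp

theorem IsRiskMinimizer.consistent {X Y : Type*} [DecidableEq Y] {H : Set (X → Y)}
    {S : List (X × Y)} {h h' : X → Y} (hh : IsRiskMinimizer H S h) (hh' : h' ∈ H)
    (hS : ∀ z ∈ S, h' z.1 = z.2) : ∀ z ∈ S, h z.1 = z.2 := by
  have h0 := hh.2 h' hh'
  rw [empiricalRisk_eq_zero_iff.2 hS] at h0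
  exact empiricalRisk_eq_zero_iff.1 (le_antisymm h0 (empiricalRisk_nonneg S h))

theorem isRiskMinimizer_of_consistent {X Y : Type*} [DecidableEq Y] {H : Set (X → Y)}
    {S : List (X × Y)} {h : X → Y} (hh : h ∈ H) (hS : ∀ z ∈ S, h z.1 = z.2) :
    IsRiskMinimizer H S h :=
  ⟨hh, fun h' _ => (empiricalRisk_eq_zero_iff.2 hS).trans_le (empiricalRisk_nonneg S h')⟩

/-- Error counts are natural numbers, so a minimum is attained even over an infinite class. -/
theorem exists_isERM {X Y : Type*} [DecidableEq Y] {H : Set (X → Y)} (hH : H.Nonempty) :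
    ∃ B : List (X × Y) → X → Y, IsERM H B := by
  have key (S : List (X × Y)) : ∃ h, IsRiskMinimizer H S h := by
    obtain ⟨h, hh, hmin⟩ := (InvImage.wf (fun h : X → Y => S.countP fun z => h z.1 ≠ z.2)
      Nat.lt_wfRel.wf).has_min H hH
    refine ⟨h, hh, fun h' hh' => ?_⟩
    have h1 : (S.countP fun z => h z.1 ≠ z.2) ≤ S.countP fun z => h' z.1 ≠ z.2 :=
      not_lt.1 (hmin h' hh')
    unfold empiricalRisk
    gcongr
  choose B hB using key
  exact ⟨B, hB⟩

theorem exists_isArgmaxRule {k : ℕ} (hk : 1 ≤ k) :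
    ∃ sel : (Fin k → ℤ) → Fin k, IsArgmaxRule sel := by
  have : Nonempty (Fin k) := ⟨⟨0, hk⟩⟩
  choose sel hsel using fun v : Fin k → ℤ => Finite.exists_max v
  exact ⟨sel, hsel⟩

/-! ### Halfspaces -/

theorem exists_ne_zero_euclideanSpace {r : ℕ} (hr : 1 ≤ r) :
    ∃ w : EuclideanSpace ℝ (Fin r), w ≠ 0 := by
  have : Nonempty (Fin r) := ⟨⟨0, hr⟩⟩
  exact exists_ne 0

theorem halfspaceClass_nonempty {r : ℕ} (hr : 1 ≤ r) : (halfspaceClass r).Nonempty := by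
  obtain ⟨w, hw⟩ := exists_ne_zero_euclideanSpace hr
  exact ⟨_, w, 0, hw, rfl⟩

theorem eq_one_or_eq_neg_one_of_mem_halfspaceClass {r : ℕ} {h : EuclideanSpace ℝ (Fin r) → ℤ}
    (hh : h ∈ halfspaceClass r) (x : EuclideanSpace ℝ (Fin r)) : h x = 1 ∨ h x = -1 := by
  obtain ⟨w, b, -, rfl⟩ := hh
  by_cases hx : 0 ≤ inner ℝ w x + b
  · exact Or.inl (if_pos hx)
  · exact Or.inr (if_neg hx)

/-- Since `w ≠ 0`, constants are not halfspaces; on a finite set a large enough offset imitates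
them. This accounts for the constant pair classifiers. -/
theorem exists_halfspace_eq_one_on {r : ℕ} (hr : 1 ≤ r)
    (P : Finset (EuclideanSpace ℝ (Fin r))) :
    ∃ h ∈ halfspaceClass r, ∀ x ∈ P, h x = 1 := by
  obtain ⟨w, hw⟩ := exists_ne_zero_euclideanSpace hr
  refine ⟨_, ⟨w, ∑ y ∈ P, |inner ℝ w y|, hw, rfl⟩, fun x hx => if_pos ?_⟩
  have h1 := Finset.single_le_sum (f := fun y => |inner ℝ w y|) (fun y _ => abs_nonneg _) hx
  have h2 := neg_abs_le (inner ℝ w x)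
  linarith

theorem exists_halfspace_eq_neg_one_on {r : ℕ} (hr : 1 ≤ r)
    (P : Finset (EuclideanSpace ℝ (Fin r))) :
    ∃ h ∈ halfspaceClass r, ∀ x ∈ P, h x = -1 := by
  obtain ⟨w, hw⟩ := exists_ne_zero_euclideanSpace hr
  -- The hyperplane counts as positive, so the extra `-1` is needed for strictness.
  refine ⟨_, ⟨w, -(∑ y ∈ P, |inner ℝ w y|) - 1, hw, rfl⟩, fun x hx => if_neg ?_⟩
  have h1 := Finset.single_le_sum (f := fun y => |inner ℝ w y|) (fun y _ => abs_nonneg _) hx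
  have h2 := le_abs_self (inner ℝ w x)
  linarith

/-- The bisecting hyperplane of `u ≠ v` separates the points closer to `u` from the points
closer to `v`. -/
theorem exists_halfspace_bisector {r : ℕ} {u v : EuclideanSpace ℝ (Fin r)} (huv : u ≠ v) :
    ∃ h ∈ halfspaceClass r,
      (∀ x, dist x u < dist x v → h x = 1) ∧ ∀ x, dist x v < dist x u → h x = -1 := by
  have key (x : EuclideanSpace ℝ (Fin r)) :
      inner ℝ (u - v) x + (‖v‖ ^ 2 - ‖u‖ ^ 2) / 2 = (dist x v ^ 2 - dist x u ^ 2) / 2 := by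
    rw [dist_eq_norm, dist_eq_norm, @norm_sub_sq_real, @norm_sub_sq_real, inner_sub_left,
      real_inner_comm x u, real_inner_comm x v]
    ring
  refine ⟨_, ⟨u - v, (‖v‖ ^ 2 - ‖u‖ ^ 2) / 2, sub_ne_zero.2 huv, rfl⟩,
    fun x hx => if_pos ?_, fun x hx => if_neg ?_⟩
  · rw [key]
    have := pow_le_pow_left₀ dist_nonneg hx.le 2
    linarith
  · rw [key]
    have := pow_lt_pow_left₀ hx dist_nonneg two_ne_zero
    linarith

/-- For two clusters of an optimal clustering there is a halfspace that contains the first and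
misses the second. -/
theorem exists_halfspace_separating {k r : ℕ} (hr : 1 ≤ r)
    {I : KMeansInstance (EuclideanSpace ℝ (Fin r))} (hI : I.NoBoundaryPoints k)
    {O : KClustering I k} (hO : O.IsOptimal) {a b : Fin k} (hab : a ≠ b) :
    ∃ h ∈ halfspaceClass r, (∀ p : I.P, O.label p = a → h p = 1) ∧
      ∀ p : I.P, O.label p = b → h p = -1 := by
  -- With equal centers, a point in either cluster would be strictly closer to its center than to
  -- the same point; both clusters are empty and any halfspace serves.
  by_cases hc : O.center a = O.center b
  · obtain ⟨h, hh⟩ := halfspaceClass_nonempty hr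
    refine ⟨h, hh, ?_, ?_⟩
    · rintro p rfl
      have := hI O hO p b hab.symm
      rw [hc] at this
      exact absurd this (lt_irrefl _)
    · rintro p rfl
      have := hI O hO p a hab
      rw [hc] at this
      exact absurd this (lt_irrefl _)
  · obtain ⟨h, hh, h1, h2⟩ := exists_halfspace_bisector hc
    refine ⟨h, hh, ?_, ?_⟩
    · rintro p rfl
      exact h1 _ (hI O hO p b hab.symm)
    · rintro p rfl
      exact h2 _ (hI O hO p a hab)

/-! ### The all-pairs vote -/

/-- The label `a` reaches the maximal score `k - 1`; any other label loses to `a` and stays below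
it. -/
theorem allPairsVote_eq_of_forall {X : Type*} {k : ℕ} {sel : (Fin k → ℤ) → Fin k}
    (hsel : IsArgmaxRule sel) {g : Fin k → Fin k → X → ℤ} {x : X} {a : Fin k}
    (hle : ∀ b c, b ≠ c → g b c x ≤ 1) (hwin : ∀ b, b ≠ a → g a b x = 1)
    (hlose : ∀ b, b ≠ a → g b a x = -1) : allPairsVote sel g x = a := by
  by_contra hne
  have hmax := hsel (fun a => ∑ b ∈ Finset.univ.erase a, g a b x) a
  change _ ≤ ∑ b ∈ Finset.univ.erase (allPairsVote sel g x), g (allPairsVote sel g x) b x at hmax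
  set c := allPairsVote sel g x
  have h1 : ∑ b ∈ Finset.univ.erase a, g a b x = ∑ b ∈ Finset.univ.erase a, (1 : ℤ) :=
    Finset.sum_congr rfl fun b hb => hwin b (Finset.ne_of_mem_erase hb)
  have h2 : ∑ b ∈ Finset.univ.erase c, g c b x < ∑ b ∈ Finset.univ.erase c, (1 : ℤ) := by
    refine Finset.sum_lt_sum (fun b hb => hle c b (Finset.ne_of_mem_erase hb).symm)
      ⟨a, Finset.mem_erase.2 ⟨Ne.symm hne, Finset.mem_univ a⟩, ?_⟩
    rw [hlose c hne]
    norm_num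
  simp only [Finset.sum_const, Finset.card_erase_of_mem (Finset.mem_univ _)] at h1 h2
  linarith

/-- If every label of `A` beats every label outside `A`, then the vote selects a label of `A`. -/
theorem allPairsVote_mem {X : Type*} {k : ℕ} {sel : (Fin k → ℤ) → Fin k}
    (hsel : IsArgmaxRule sel) {g : Fin k → Fin k → X → ℤ} {x : X} {A : Set (Fin k)}
    (hA : A.Nonempty) (hg : ∀ b c, b ≠ c → g b c x = 1 ∨ g b c x = -1)
    (hwin : ∀ a ∈ A, ∀ b ∉ A, g a b x = 1) (hlose : ∀ a ∈ A, ∀ b ∉ A, g b a x = -1) :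
    allPairsVote sel g x ∈ A := by
  classical
  by_contra hc
  obtain ⟨a, ha⟩ := hA
  have hmax := hsel (fun a => ∑ b ∈ Finset.univ.erase a, g a b x) a
  change _ ≤ ∑ b ∈ Finset.univ.erase (allPairsVote sel g x), g (allPairsVote sel g x) b x at hmax
  set c := allPairsVote sel g x
  -- The vector `u` holds the worst results of a label in `A` and the best results of a label
  -- outside. With `s = ∑ b, u b`, labels in `A` score at least `s + 1` and the others at most `s -
  -- 1`, because the omitted diagonal term is `-1` or `1`. No antisymmetry of `g` is required.
  let u : Fin k → ℤ := fun b => if b ∈ A then -1 else 1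
  have h1 : ∑ b ∈ Finset.univ.erase a, u b ≤ ∑ b ∈ Finset.univ.erase a, g a b x := by
    refine Finset.sum_le_sum fun b hb => ?_
    by_cases hbA : b ∈ A
    · have := hg a b (Finset.ne_of_mem_erase hb).symm
      simp only [u, if_pos hbA]
      omega
    · simp only [u, if_neg hbA, hwin a ha b hbA, le_refl]
  have h2 : ∑ b ∈ Finset.univ.erase c, g c b x ≤ ∑ b ∈ Finset.univ.erase c, u b := by
    refine Finset.sum_le_sum fun b hb => ?_
    by_cases hbA : b ∈ A
    · simp only [u, if_pos hbA, hlose b hbA c hc, le_refl]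
    · have := hg c b (Finset.ne_of_mem_erase hb).symm
      simp only [u, if_neg hbA]
      omega
  rw [Finset.sum_erase_eq_sub (Finset.mem_univ _)] at h1
  rw [Finset.sum_erase_eq_sub (f := u) (Finset.mem_univ _)] at h2
  simp only [u, if_pos ha, if_neg hc] at h1 h2
  linarith

/-! ### The pair classifiers -/

theorem mem_pairSample {X : Type*} {k : ℕ} {S : List (X × Fin k)} {a b : Fin k} {z : X × ℤ} :
    z ∈ pairSample S a b ↔
      ∃ y ∈ S, y.2 = a ∧ z = (y.1, 1) ∨ y.2 ≠ a ∧ y.2 = b ∧ z = (y.1, -1) := by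
  simp only [pairSample, List.mem_filterMap]
  refine exists_congr fun y => ?_
  by_cases ha : y.2 = a
  · simp [ha, eq_comm]
  · by_cases hb : y.2 = b
    · simp [hb, eq_comm]
      grind
    · simp [ha, hb]

theorem pairClassifier_eq_one_or_neg_one {k r : ℕ}
    {B : List (EuclideanSpace ℝ (Fin r) × ℤ) → EuclideanSpace ℝ (Fin r) → ℤ}
    (hB : IsERM (halfspaceClass r) B) (S : List (EuclideanSpace ℝ (Fin r) × Fin k)) (a b : Fin k)
    (x : EuclideanSpace ℝ (Fin r)) :
    pairClassifier B S a b x = 1 ∨ pairClassifier B S a b x = -1 := by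
  unfold pairClassifier
  split_ifs
  · exact Or.inl rfl
  · exact Or.inr rfl
  · exact eq_one_or_eq_neg_one_of_mem_halfspaceClass (hB _).1 x

/-- On finitely many points the pair classifiers are halfspaces. -/
theorem exists_halfspace_eq_pairClassifier_on {k r : ℕ} (hr : 1 ≤ r)
    {B : List (EuclideanSpace ℝ (Fin r) × ℤ) → EuclideanSpace ℝ (Fin r) → ℤ}
    (hB : IsERM (halfspaceClass r) B) (S : List (EuclideanSpace ℝ (Fin r) × Fin k)) (a b : Fin k)
    (P : Finset (EuclideanSpace ℝ (Fin r))) :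
    ∃ h ∈ halfspaceClass r, ∀ x ∈ P, h x = pairClassifier B S a b x := by
  unfold pairClassifier
  split_ifs
  · exact exists_halfspace_eq_one_on hr P
  · exact exists_halfspace_eq_neg_one_on hr P
  · exact ⟨_, (hB _).1, fun _ _ => rfl⟩

theorem mem_labeled {α β : Type*} {f : α → β} {s : List α} {z : α × β} :
    z ∈ labeled f s ↔ ∃ x ∈ s, (x, f x) = z :=
  List.mem_map

/-- The labeled sample that the all-pairs learner passes on to the pair classifiers. -/
theorem seen_map_labeled {X : Type*} {k : ℕ} {P : Finset X} {f : P → Fin k} {s : List P}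
    {a : Fin k} :
    Seen ((labeled f s).map fun z => ((z.1 : X), z.2)) a ↔ ∃ p ∈ s, f p = a := by
  simp [Seen, labeled]

/-- Both orders are treated because `B` may fit `S_{a,b}` and `S_{b,a}` by unrelated hyperplanes. If
`b` is seen, realizability makes `B` consistent; otherwise the convention decides. -/
theorem pairClassifier_of_mem {k r : ℕ} (hr : 1 ≤ r)
    {B : List (EuclideanSpace ℝ (Fin r) × ℤ) → EuclideanSpace ℝ (Fin r) → ℤ}
    (hB : IsERM (halfspaceClass r) B)
    {I : KMeansInstance (EuclideanSpace ℝ (Fin r))} (hI : I.NoBoundaryPoints k)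
    {O : KClustering I k} (hO : O.IsOptimal) {s : List I.P} {p : I.P} (hp : p ∈ s)
    {b : Fin k} (hb : b ≠ O.label p) :
    pairClassifier B ((labeled O.label s).map fun z => ((z.1 : EuclideanSpace ℝ (Fin r)), z.2))
        (O.label p) b p = 1 ∧
    pairClassifier B ((labeled O.label s).map fun z => ((z.1 : EuclideanSpace ℝ (Fin r)), z.2))
        b (O.label p) p = -1 := by
  set S := (labeled O.label s).map fun z => ((z.1 : EuclideanSpace ℝ (Fin r)), z.2) with hS
  have hseen : Seen S (O.label p) := seen_map_labeled.2 ⟨p, hp, rfl⟩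
  have hmem : ((p : EuclideanSpace ℝ (Fin r)), O.label p) ∈ S := by
    simp only [hS, labeled, List.map_map, List.mem_map]
    exact ⟨p, hp, rfl⟩
  have hsep {c d : Fin k} (hcd : c ≠ d) :
      ∀ z ∈ pairSample S c d, B (pairSample S c d) z.1 = z.2 := by
    obtain ⟨h, hh, h1, h2⟩ := exists_halfspace_separating hr hI hO hcd
    refine (hB _).consistent hh fun z hz => ?_
    obtain ⟨y, hy, hyz⟩ := mem_pairSample.1 hz
    simp only [hS, labeled, List.map_map, List.mem_map] at hy
    obtain ⟨q, -, rfl⟩ := hy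
    rcases hyz with ⟨hq, rfl⟩ | ⟨-, hq, rfl⟩
    · exact h1 q hq
    · exact h2 q hq
  unfold pairClassifier
  by_cases hbs : Seen S b
  · simp only [hseen, hbs, not_true_eq_false, and_false, false_and, if_false]
    exact ⟨hsep hb.symm (_, 1) (mem_pairSample.2 ⟨_, hmem, Or.inl ⟨rfl, rfl⟩⟩),
      hsep hb (_, -1) (mem_pairSample.2 ⟨_, hmem, Or.inr ⟨hb.symm, rfl, rfl⟩⟩)⟩
  · simp [hseen, hbs]

theorem allPairsLearner_zeroSampleError {k r : ℕ} (hr : 1 ≤ r)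
    {B : List (EuclideanSpace ℝ (Fin r) × ℤ) → EuclideanSpace ℝ (Fin r) → ℤ}
    {sel : (Fin k → ℤ) → Fin k} (hB : IsERM (halfspaceClass r) B) (hsel : IsArgmaxRule sel) :
    (allPairsLearner B sel).ZeroSampleError (euclideanFamily k r) := by
  intro I hI O hO s p hp
  refine allPairsVote_eq_of_forall hsel (fun b c _ => ?_)
    (fun b hb => (pairClassifier_of_mem hr hB hI.2 hO hp hb).1)
    (fun b hb => (pairClassifier_of_mem hr hB hI.2 hO hp hb).2)
  have := pairClassifier_eq_one_or_neg_one hB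
    ((labeled O.label s).map fun z => ((z.1 : EuclideanSpace ℝ (Fin r)), z.2)) b c p
  omega

theorem allPairsLearner_nonInventive {k r : ℕ}
    {B : List (EuclideanSpace ℝ (Fin r) × ℤ) → EuclideanSpace ℝ (Fin r) → ℤ}
    {sel : (Fin k → ℤ) → Fin k} (hB : IsERM (halfspaceClass r) B) (hsel : IsArgmaxRule sel) :
    (allPairsLearner B sel).NonInventive (euclideanFamily k r) := by
  intro I _ O _ s hs x
  obtain ⟨q, hq⟩ := List.exists_mem_of_ne_nil s hs
  set S := (labeled O.label s).map fun z => ((z.1 : EuclideanSpace ℝ (Fin r)), z.2)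
  have hseen : Seen S (allPairsVote sel (pairClassifier B S) (x : EuclideanSpace ℝ (Fin r))) := by
    refine allPairsVote_mem hsel (A := {a | Seen S a})
      ⟨O.label q, seen_map_labeled.2 ⟨q, hq, rfl⟩⟩
      (fun b c _ => pairClassifier_eq_one_or_neg_one hB S b c x) ?_ ?_
    · intro a ha b hb
      rw [pairClassifier, if_pos ⟨ha, hb⟩]
    · intro a ha b hb
      rw [pairClassifier, if_neg (fun h => hb h.1), if_pos ⟨hb, ha⟩]
  exact seen_map_labeled.1 hseen

theorem allPairsLearner_isAllPairsERM {k r : ℕ} (hr : 1 ≤ r)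
    {B : List (EuclideanSpace ℝ (Fin r) × ℤ) → EuclideanSpace ℝ (Fin r) → ℤ}
    {sel : (Fin k → ℤ) → Fin k} (hB : IsERM (halfspaceClass r) B) (hsel : IsArgmaxRule sel) :
    (allPairsLearner B sel).IsAllPairsERM sel (euclideanFamily k r) := by
  intro I hI O hO s
  refine isRiskMinimizer_of_consistent ?_ ?_
  · choose g hg hgP using fun a b : Fin k => exists_halfspace_eq_pairClassifier_on hr hB
      ((labeled O.label s).map fun z => ((z.1 : EuclideanSpace ℝ (Fin r)), z.2)) a b I.P
    refine ⟨g, fun a b _ => hg a b, funext fun p => ?_⟩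
    simp only [allPairsLearner, allPairsVote, hgP _ _ p p.2]
  · intro z hz
    obtain ⟨p, hp, rfl⟩ := mem_labeled.1 hz
    exact allPairsLearner_zeroSampleError hr hB hsel I hI O hO s p hp

/-! ### Growth functions -/

theorem sum_choose_le_pow (M d : ℕ) : ∑ i ∈ Finset.range (d + 1), M.choose i ≤ (M + 1) ^ d := by
  induction d with
  | zero => simp
  | succ d ih =>
    rw [Finset.sum_range_succ]
    calc _ ≤ (M + 1) ^ d + M ^ d * M := by
            rw [← pow_succ]
            exact add_le_add ih (Nat.choose_le_pow _ _)
      _ ≤ (M + 1) ^ d + (M + 1) ^ d * M := by gcongr; omega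
      _ = (M + 1) ^ (d + 1) := by ring

/-- The Sauer–Shelah bound for a family of subsets of `W`. -/
theorem card_le_pow_of_shatters {α : Type*} [DecidableEq α] {𝒜 : Finset (Finset α)}
    {W : Finset α} {d : ℕ} (hW : ∀ A ∈ 𝒜, A ⊆ W) (hd : ∀ s, 𝒜.Shatters s → s.card ≤ d) :
    𝒜.card ≤ (W.card + 1) ^ d := by
  have hsub : 𝒜.shatterer ⊆ (Finset.range (d + 1)).biUnion fun i => W.powersetCard i := by
    intro s hs
    rw [Finset.mem_shatterer] at hs
    obtain ⟨t, ht, hst⟩ := hs.exists_superset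
    exact Finset.mem_biUnion.2 ⟨s.card, Finset.mem_range.2 (Nat.lt_succ_of_le (hd s hs)),
      Finset.mem_powersetCard.2 ⟨hst.trans (hW t ht), rfl⟩⟩
  calc 𝒜.card ≤ 𝒜.shatterer.card := Finset.card_le_card_shatterer 𝒜
    _ ≤ _ := Finset.card_le_card hsub
    _ ≤ ∑ i ∈ Finset.range (d + 1), (W.powersetCard i).card := Finset.card_biUnion_le
    _ = ∑ i ∈ Finset.range (d + 1), W.card.choose i := by simp only [Finset.card_powersetCard]
    _ ≤ _ := sum_choose_le_pow _ _

open Classical in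
/-- The subsets of `W` that are cut out by halfspaces, for points indexed by `φ`. -/
noncomputable def halfspaceTraces {τ : Type*} {r : ℕ} (φ : τ → EuclideanSpace ℝ (Fin r))
    (W : Finset τ) : Finset (Finset τ) :=
  W.powerset.filter fun A => ∃ h ∈ halfspaceClass r, A = W.filter fun t => h (φ t) = 1

open Classical in
-- Among `r + 2` indexed points, Radon's theorem finds a subfamily whose convex hull meets that of
-- its complement. A halfspace cutting out exactly this subfamily would both contain and miss the
-- common point.
theorem card_le_of_shatters_halfspaceTraces {τ : Type*} {r : ℕ}
    {φ : τ → EuclideanSpace ℝ (Fin r)} {W s : Finset τ}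
    (hs : (halfspaceTraces φ W).Shatters s) : s.card ≤ r + 1 := by
  by_contra! hcard
  have hdep : ¬ AffineIndependent ℝ fun t : s => φ t := by
    intro hind
    have h1 := hind.card_le_finrank_succ
    have h2 := Submodule.finrank_le (vectorSpan ℝ (Set.range fun t : s => φ t))
    rw [Fintype.card_coe] at h1
    rw [finrank_euclideanSpace_fin] at h2
    omega
  obtain ⟨J, x, hx1, hx2⟩ := Convex.radon_partition hdep
  obtain ⟨A, hA, hsA⟩ := hs (t := s.filter fun t => ∃ h : t ∈ s, (⟨t, h⟩ : s) ∈ J)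
    (Finset.filter_subset _ _)
  obtain ⟨-, h, ⟨w, b, -, rfl⟩, rfl⟩ := Finset.mem_filter.1 hA
  have hsW : s ⊆ W := by
    obtain ⟨A', hA', hsA'⟩ := hs.exists_superset
    exact hsA'.trans (Finset.mem_powerset.1 (Finset.mem_filter.1 hA').1)
  have hiff (t : s) : t ∈ J ↔ 0 ≤ inner ℝ w (φ t) + b := by
    have := Finset.ext_iff.1 hsA t
    simp only [Finset.mem_inter, Finset.mem_filter, t.2, hsW t.2, true_and, Subtype.coe_eta,
      exists_true_left] at this
    rw [← this]
    split_ifs with hi <;> simp [hi]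
  have hlin : IsLinearMap ℝ fun y : EuclideanSpace ℝ (Fin r) => inner ℝ w y :=
    (innerₛₗ ℝ w).isLinear
  have hx3 : -b ≤ inner ℝ w x := by
    refine convexHull_min ?_ (convex_halfSpace_ge hlin (-b)) hx1
    rintro _ ⟨t, ht, rfl⟩
    have := (hiff t).1 ht
    simp only [Set.mem_ofPred_eq]
    linarith
  have hx4 : inner ℝ w x < -b := by
    refine convexHull_min ?_ (convex_halfSpace_lt hlin (-b)) hx2
    rintro _ ⟨t, ht, rfl⟩
    have := mt (hiff t).2 ht
    simp only [Set.mem_ofPred_eq]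
    linarith
  linarith

theorem card_halfspaceTraces_le {τ : Type*} {r : ℕ} (φ : τ → EuclideanSpace ℝ (Fin r))
    (W : Finset τ) : (halfspaceTraces φ W).card ≤ (W.card + 1) ^ (r + 1) := by
  classical
  exact card_le_pow_of_shatters
    (fun A hA => Finset.mem_powerset.1 (Finset.mem_filter.1 hA).1)
    fun s hs => card_le_of_shatters_halfspaceTraces (by convert hs)

/-- The growth function of the error sets of all-pairs votes of halfspaces. -/
theorem card_image_inter_errorSets_le {τ : Type*} [DecidableEq τ] {k r : ℕ}
    (sel : (Fin k → ℤ) → Fin k) (φ : τ → EuclideanSpace ℝ (Fin r)) (f : τ → Fin k)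
    {𝓔 : Finset (Finset τ)}
    (h𝓔 : ∀ E ∈ 𝓔, ∃ g : Fin k → Fin k → EuclideanSpace ℝ (Fin r) → ℤ,
      (∀ a b, a ≠ b → g a b ∈ halfspaceClass r) ∧
        ∀ t, t ∈ E ↔ allPairsVote sel g (φ t) ≠ f t) (hr : (halfspaceClass r).Nonempty)
    (W : Finset τ) :
    (𝓔.image (· ∩ W)).card ≤ (W.card + 1) ^ ((r + 1) * k ^ 2) := by
  classical
  let 𝒢 : Finset (Fin k → Fin k → Finset τ) :=
    Fintype.piFinset fun _ => Fintype.piFinset fun _ => halfspaceTraces φ W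
  let Φ : (Fin k → Fin k → Finset τ) → Finset τ := fun A => W.filter fun t =>
    (sel fun a => ∑ b ∈ Finset.univ.erase a, if t ∈ A a b then 1 else -1) ≠ f t
  have hsub : 𝓔.image (· ∩ W) ⊆ 𝒢.image Φ := by
    intro D hD
    obtain ⟨E, hE, rfl⟩ := Finset.mem_image.1 hD
    obtain ⟨g, hg, hgE⟩ := h𝓔 E hE
    obtain ⟨h₀, hh₀⟩ := hr
    -- The vote ignores the diagonal, where `g` is arbitrary; filling in `h₀` makes every entry a
    -- halfspace.
    let g' : Fin k → Fin k → EuclideanSpace ℝ (Fin r) → ℤ :=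
      fun a b => if a = b then h₀ else g a b
    have hg' (a b) : g' a b ∈ halfspaceClass r := by
      by_cases hab : a = b
      · simpa only [g', if_pos hab] using hh₀
      · simpa only [g', if_neg hab] using hg a b hab
    refine Finset.mem_image.2 ⟨fun a b => W.filter fun t => g' a b (φ t) = 1, ?_, ?_⟩
    · simp only [𝒢, Fintype.mem_piFinset]
      exact fun a b => Finset.mem_filter.2 ⟨Finset.mem_powerset.2 (Finset.filter_subset _ _),
        _, hg' a b, rfl⟩
    · ext t
      simp only [Φ, Finset.mem_filter, Finset.mem_inter, hgE]
      rw [and_comm]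
      refine and_congr_left fun ht => ?_
      have : (fun a => ∑ b ∈ Finset.univ.erase a,
          if t ∈ W ∧ g' a b (φ t) = 1 then (1 : ℤ) else -1) =
          fun a => ∑ b ∈ Finset.univ.erase a, g a b (φ t) := by
        funext a
        refine Finset.sum_congr rfl fun b hb => ?_
        have hab := (Finset.ne_of_mem_erase hb).symm
        simp only [g', if_neg hab, ht, true_and]
        rcases eq_one_or_eq_neg_one_of_mem_halfspaceClass (hg a b hab) (φ t) with h | h <;> simp [h]
      rw [this]
      rfl
  calc (𝓔.image (· ∩ W)).card ≤ (𝒢.image Φ).card := Finset.card_le_card hsub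
    _ ≤ 𝒢.card := Finset.card_image_le
    _ = ((halfspaceTraces φ W).card ^ k) ^ k := by simp [𝒢, Fintype.card_piFinset]
    _ ≤ (((W.card + 1) ^ (r + 1)) ^ k) ^ k := by
      gcongr
      exact card_halfspaceTraces_le φ W
    _ = _ := by rw [← pow_mul, ← pow_mul]; ring_nf

/-! ### Uniform convergence by a weighted double sample -/

/-- The weight of a pair of sample point and ghost sample point with respect to an error set. -/
def ghostWeight {τ : Type*} [DecidableEq τ] (D : Finset τ) (u v : τ) : ℕ :=
  if u ∈ D then 0 else if v ∈ D then 2 else 1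

/-- The sum is 0 if both points lie in `D` and exactly 2 otherwise. -/
theorem ghostWeight_add_swap_le {τ : Type*} [DecidableEq τ] (D : Finset τ) (u v : τ) :
    ghostWeight D u v + ghostWeight D v u ≤ 2 := by
  unfold ghostWeight
  split_ifs <;> simp

/-- Exchange sample and ghost sample at the positions selected by `σ`. -/
def ghostSwap {τ : Type*} {n : ℕ} (σ : Fin n → Bool) (z : Fin n → τ × τ) : Fin n → τ × τ :=
  fun i => if σ i then (z i).swap else z i

theorem ghostSwap_involutive {τ : Type*} {n : ℕ} (σ : Fin n → Bool) :
    Function.Involutive (ghostSwap (τ := τ) σ) := by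
  intro z
  funext i
  by_cases h : σ i <;> simp [ghostSwap, h]

/-- The points of a double sample. -/
def ghostRange {τ : Type*} [DecidableEq τ] {n : ℕ} (z : Fin n → τ × τ) : Finset τ :=
  (Finset.univ.image fun i => (z i).1) ∪ Finset.univ.image fun i => (z i).2

theorem fst_mem_ghostRange {τ : Type*} [DecidableEq τ] {n : ℕ} (z : Fin n → τ × τ) (i : Fin n) :
    (z i).1 ∈ ghostRange z :=
  Finset.mem_union_left _ (Finset.mem_image_of_mem _ (Finset.mem_univ i))

theorem snd_mem_ghostRange {τ : Type*} [DecidableEq τ] {n : ℕ} (z : Fin n → τ × τ) (i : Fin n) :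
    (z i).2 ∈ ghostRange z :=
  Finset.mem_union_right _ (Finset.mem_image_of_mem (fun i => (z i).2) (Finset.mem_univ i))

theorem card_ghostRange_le {τ : Type*} [DecidableEq τ] {n : ℕ} (z : Fin n → τ × τ) :
    (ghostRange z).card ≤ 2 * n := by
  refine (Finset.card_union_le _ _).trans ?_
  have h1 := Finset.card_image_le (s := Finset.univ) (f := fun i => (z i).1)
  have h2 := Finset.card_image_le (s := Finset.univ) (f := fun i => (z i).2)
  rw [Finset.card_fin] at h1 h2
  omega

theorem ghostRange_ghostSwap {τ : Type*} [DecidableEq τ] {n : ℕ} (σ : Fin n → Bool)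
    (z : Fin n → τ × τ) : ghostRange (ghostSwap σ z) = ghostRange z := by
  have key (σ : Fin n → Bool) (z : Fin n → τ × τ) :
      ghostRange (ghostSwap σ z) ⊆ ghostRange z := by
    intro t ht
    simp only [ghostRange, Finset.mem_union, Finset.mem_image, Finset.mem_univ, true_and] at ht
    rcases ht with ⟨i, rfl⟩ | ⟨i, rfl⟩ <;> by_cases h : σ i <;>
      simp [ghostSwap, h, fst_mem_ghostRange, snd_mem_ghostRange]
  refine (key σ z).antisymm ?_
  conv_lhs => rw [← ghostSwap_involutive σ z]
  exact key σ _

/-- The swaps are independent, so the sum factors over the positions. -/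
theorem sum_ghostSwap_prod_ghostWeight_le {τ : Type*} [DecidableEq τ] {n : ℕ} (D : Finset τ)
    (z : Fin n → τ × τ) :
    ∑ σ : Fin n → Bool, ∏ i, ghostWeight D (ghostSwap σ z i).1 (ghostSwap σ z i).2 ≤ 2 ^ n := by
  have h := Finset.prod_univ_sum (fun _ : Fin n => (Finset.univ : Finset Bool))
    fun i s => ghostWeight D (if s then (z i).swap else z i).1 (if s then (z i).swap else z i).2
  rw [Fintype.piFinset_univ] at h
  refine (h.symm.trans_le (Finset.prod_le_prod' fun i _ => ?_)).trans_eq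
    (Finset.prod_const 2 |>.trans (by rw [Finset.card_fin]))
  simpa [add_comm] using ghostWeight_add_swap_le D (z i).1 (z i).2

/-- Swapping permutes the double samples and preserves their point set, hence also the set of
traces. The sum may thus be averaged over all swaps, where each of the at most `G` traces
contributes at most 1. -/
theorem sum_traces_prod_ghostWeight_le {τ : Type*} [Fintype τ] [DecidableEq τ]
    {𝓔 : Finset (Finset τ)} {n G : ℕ}
    (hG : ∀ W : Finset τ, W.card ≤ 2 * n → (𝓔.image (· ∩ W)).card ≤ G) :
    ∑ z : Fin n → τ × τ, ∑ D ∈ 𝓔.image (· ∩ ghostRange z),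
      ∏ i, ghostWeight D (z i).1 (z i).2 ≤ G * (Fintype.card τ ^ n * Fintype.card τ ^ n) := by
  set F : (Fin n → τ × τ) → ℕ := fun z =>
    ∑ D ∈ 𝓔.image (· ∩ ghostRange z), ∏ i, ghostWeight D (z i).1 (z i).2 with hF
  have hswap (σ : Fin n → Bool) : ∑ z, F (ghostSwap σ z) = ∑ z, F z :=
    Equiv.sum_comp (ghostSwap_involutive σ).toPerm F
  have hpt (z : Fin n → τ × τ) : ∑ σ : Fin n → Bool, F (ghostSwap σ z) ≤ G * 2 ^ n := by
    simp only [hF, ghostRange_ghostSwap]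
    rw [Finset.sum_comm]
    calc _ ≤ ∑ D ∈ 𝓔.image (· ∩ ghostRange z), 2 ^ n :=
          Finset.sum_le_sum fun D _ => sum_ghostSwap_prod_ghostWeight_le D z
      _ = (𝓔.image (· ∩ ghostRange z)).card * 2 ^ n := by simp
      _ ≤ _ := Nat.mul_le_mul_right _ (hG _ (card_ghostRange_le z))
  have htot : 2 ^ n * ∑ z, F z ≤ 2 ^ n * (G * (Fintype.card τ ^ n * Fintype.card τ ^ n)) := by
    calc 2 ^ n * ∑ z, F z = ∑ σ : Fin n → Bool, ∑ z, F (ghostSwap σ z) := by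
          simp [hswap]
      _ = ∑ z, ∑ σ : Fin n → Bool, F (ghostSwap σ z) := Finset.sum_comm
      _ ≤ ∑ z : Fin n → τ × τ, G * 2 ^ n := Finset.sum_le_sum fun z _ => hpt z
      _ = _ := by
        simp [mul_pow]
        ring
  exact Nat.le_of_mul_le_mul_left htot (by positivity)

/-- As `x` misses `E`, each ghost point weighs 2 in `E` and 1 outside, independently of the others.
-/
theorem sum_prod_ghostWeight_eq {τ : Type*} [Fintype τ] [DecidableEq τ] {n : ℕ} {E : Finset τ}
    {x : Fin n → τ} (hx : ∀ i, x i ∉ E) :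
    ∑ y : Fin n → τ, ∏ i, ghostWeight E (x i) (y i) = (Fintype.card τ + E.card) ^ n := by
  have h : ∑ v : τ, (if v ∈ E then 2 else 1) = Fintype.card τ + E.card := by
    have : ∀ v : τ, (if v ∈ E then 2 else 1) = 1 + if v ∈ E then 1 else 0 := by
      intro v; split_ifs <;> rfl
    simp [this, Finset.sum_add_distrib]
  rw [← h, Fintype.sum_pow]
  simp [ghostWeight, hx]

/-- Few samples miss a large set of a family with small growth function. -/
theorem card_bad_mul_le {τ : Type*} [Fintype τ] [DecidableEq τ] {𝓔 : Finset (Finset τ)} {n G : ℕ}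
    (hG : ∀ W : Finset τ, W.card ≤ 2 * n → (𝓔.image (· ∩ W)).card ≤ G)
    (hτ : 0 < Fintype.card τ) {ε : ℝ} (hε : 0 ≤ ε) (bad : Finset (Fin n → τ))
    (hbad : ∀ x ∈ bad, ∃ E ∈ 𝓔, (∀ i, x i ∉ E) ∧ ε * Fintype.card τ ≤ E.card) :
    (bad.card : ℝ) * (1 + ε) ^ n ≤ G * (Fintype.card τ : ℝ) ^ n := by
  have hx : ∀ x ∈ bad, ((1 + ε) * Fintype.card τ) ^ n ≤
      ((∑ y : Fin n → τ, ∑ D ∈ 𝓔.image (· ∩ ghostRange fun i => (x i, y i)),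
        ∏ i, ghostWeight D (x i) (y i) : ℕ) : ℝ) := by
    intro x hx
    obtain ⟨E, hE, hxE, hcard⟩ := hbad x hx
    calc ((1 + ε) * Fintype.card τ) ^ n ≤ (((Fintype.card τ + E.card) ^ n : ℕ) : ℝ) := by
          push_cast
          have : (1 + ε) * Fintype.card τ ≤ Fintype.card τ + E.card := by linarith
          gcongr
      _ = ((∑ y : Fin n → τ, ∏ i, ghostWeight E (x i) (y i) : ℕ) : ℝ) := by
          rw [sum_prod_ghostWeight_eq hxE]
      _ ≤ _ := by
          refine Nat.cast_le.2 (Finset.sum_le_sum fun y _ => ?_)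
          set z : Fin n → τ × τ := fun i => (x i, y i)
          -- The weights only see the trace of `E` on the double sample, so this product is one term
          -- of the sum over traces.
          have : ∏ i, ghostWeight E (x i) (y i) =
              ∏ i, ghostWeight (E ∩ ghostRange z) (x i) (y i) := by
            refine Finset.prod_congr rfl fun i _ => ?_
            have h1 : x i ∈ ghostRange z := fst_mem_ghostRange z i
            have h2 : y i ∈ ghostRange z := snd_mem_ghostRange z i
            simp [ghostWeight, h1, h2]
          rw [this]
          exact Finset.single_le_sum
            (f := fun D => ∏ i, ghostWeight D (x i) (y i)) (fun _ _ => Nat.zero_le _)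
            (Finset.mem_image_of_mem _ hE)
  have htotal : (∑ x : Fin n → τ, ∑ y : Fin n → τ,
      ∑ D ∈ 𝓔.image (· ∩ ghostRange fun i => (x i, y i)), ∏ i, ghostWeight D (x i) (y i)) ≤
      G * (Fintype.card τ ^ n * Fintype.card τ ^ n) := by
    refine le_trans (le_of_eq ?_) (sum_traces_prod_ghostWeight_le hG)
    rw [← Fintype.sum_prod_type', ← Equiv.sum_comp
      (Equiv.arrowProdEquivProdArrow (Fin n) (fun _ => τ) fun _ => τ)]
    rfl
  have hpos : (0 : ℝ) < (Fintype.card τ : ℝ) ^ n := by positivity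
  refine le_of_mul_le_mul_right ?_ hpos
  calc (bad.card : ℝ) * (1 + ε) ^ n * (Fintype.card τ : ℝ) ^ n
      = ∑ x ∈ bad, ((1 + ε) * Fintype.card τ) ^ n := by
        rw [Finset.sum_const, nsmul_eq_mul, mul_pow]; ring
    _ ≤ _ := Finset.sum_le_sum hx
    _ ≤ _ := by
        rw [← Nat.cast_sum]
        exact Nat.cast_le.2 (Finset.sum_le_univ_sum_of_nonneg fun _ => Nat.zero_le _)
    _ ≤ _ := Nat.cast_le.2 htotal
    _ = _ := by push_cast; ring

/-! ### The sample complexity -/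

/-- A sample size at which the failure probability of the double-sample bound is at most `δ`. -/
theorem growth_le_of_le {k r n : ℕ} (hk : 2 ≤ k) (hr : 1 ≤ r) {ε δ : ℝ}
    (hε : ε ∈ Set.Ioo (0 : ℝ) 1) (hδ : δ ∈ Set.Ioo (0 : ℝ) 1)
    (hn : 24 * (((k : ℝ) ^ 2 * (r : ℝ) * Real.log ((k : ℝ) ^ 2 * (r : ℝ))
      * Real.log ((k : ℝ) ^ 3 * (r : ℝ) / ε) + Real.log (1 / δ)) / ε) ≤ n) :
    (2 * n + 1 : ℝ) ^ ((r + 1) * k ^ 2) ≤ δ * (1 + ε) ^ n := by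
  obtain ⟨hε0, hε1⟩ := hε
  obtain ⟨hδ0, hδ1⟩ := hδ
  have hk' : (2 : ℝ) ≤ k := by exact_mod_cast hk
  have hr' : (1 : ℝ) ≤ r := by exact_mod_cast hr
  set R : ℝ := (k : ℝ) ^ 2 * r with hR
  have hk2 : (4 : ℝ) ≤ (k : ℝ) ^ 2 := by nlinarith
  have hR4 : (4 : ℝ) ≤ R := by nlinarith
  have hK : (k : ℝ) ^ 3 * r / ε = k * R / ε := by rw [hR]; ring
  rw [hK] at hn
  set y : ℝ := k * R / ε with hy
  have hy8 : 8 ≤ y := by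
    rw [hy, le_div_iff₀ hε0]
    nlinarith
  -- This uses `R ≥ 4 > e`, hence `k ≥ 2`; it lets the factor `log R` be inserted for free in `hRy`.
  have hlogR : 1 ≤ Real.log R := by
    rw [Real.le_log_iff_exp_le (by linarith)]
    have := Real.exp_one_lt_d9
    linarith
  have hlogδ : 0 < Real.log (1 / δ) := Real.log_pos (by rw [lt_div_iff₀ hδ0]; linarith)
  have hlogy : 0 < Real.log y := Real.log_pos (by linarith)
  set D : ℝ := ((r : ℝ) + 1) * k ^ 2 with hD
  have hD2 : D ≤ 2 * R := by rw [hD, hR]; nlinarith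
  have hD0 : 0 < D := by rw [hD]; positivity
  -- Here `D ≤ 2R ≤ kR` gives `16D/ε ≤ 16y`, and `16y ≤ y ^ 3` because `y ≥ 8`.
  have hlog16 : Real.log (16 * D / ε) ≤ 3 * Real.log y := by
    have h1 : 16 * D / ε ≤ y ^ 3 := by
      have h2 : 16 * D / ε ≤ 16 * y := by
        rw [hy, ← mul_div_assoc]
        gcongr
        nlinarith
      nlinarith [mul_le_mul hy8 hy8 (by norm_num) (by linarith)]
    calc _ ≤ Real.log (y ^ 3) := Real.log_le_log (by positivity) h1
      _ = _ := by rw [Real.log_pow]; norm_num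
  have hn1 : 24 * (R * Real.log R * Real.log y + Real.log (1 / δ)) ≤ n * ε := by
    rwa [← mul_div_assoc, div_le_iff₀ hε0] at hn
  have hRy : R * Real.log y ≤ R * Real.log R * Real.log y := by
    have : R * 1 ≤ R * Real.log R := by gcongr
    nlinarith
  have hn0 : (1 : ℝ) ≤ n := by
    have : (0 : ℝ) < n := by
      have : 0 < R * Real.log y := by positivity
      by_contra! hneg
      nlinarith
    exact_mod_cast this
  have hmain : D * Real.log (2 * n + 1) ≤ Real.log δ + n * Real.log (1 + ε) := by
    -- This is `log t ≤ t - 1` at the scale `ε / (16D)`, chosen so that `D` times the linear term is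
    -- only about `nε/8`.
    have h1 : Real.log (2 * n + 1) ≤ ε / (16 * D) * (2 * n + 1) + Real.log (16 * D / ε) := by
      have h2 := Real.log_le_sub_one_of_pos (x := ε / (16 * D) * (2 * n + 1)) (by positivity)
      have h3 : Real.log (2 * n + 1) =
          Real.log (ε / (16 * D) * (2 * n + 1)) + Real.log (16 * D / ε) := by
        rw [← Real.log_mul (by positivity) (by positivity)]
        congr 1
        field_simp
      linarith
    have h4 : D * Real.log (2 * n + 1) ≤ ε * (2 * n + 1) / 16 + D * Real.log (16 * D / ε) := by
      calc _ ≤ D * (ε / (16 * D) * (2 * n + 1) + Real.log (16 * D / ε)) := by gcongr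
        _ = _ := by field_simp
    have h5 : D * Real.log (16 * D / ε) ≤ 2 * R * (3 * Real.log y) := by
      calc _ ≤ D * (3 * Real.log y) := by gcongr
        _ ≤ _ := by gcongr
    have h6 : ε / 2 ≤ Real.log (1 + ε) := by
      have h7 := Real.one_sub_inv_le_log_of_pos (x := 1 + ε) (by linarith)
      have h8 : ε / 2 ≤ 1 - (1 + ε)⁻¹ := by
        have : 1 - (1 + ε)⁻¹ = ε / (1 + ε) := by field_simp; ring
        rw [this]
        gcongr
        linarith
      linarith
    have h9 : (n : ℝ) * (ε / 2) ≤ n * Real.log (1 + ε) := by gcongr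
    have h10 : Real.log δ = -Real.log (1 / δ) := by rw [one_div, Real.log_inv, neg_neg]
    have h11 : ε ≤ n * ε := by nlinarith
    -- The budget: `ε(2n+1)/16 ≤ 3nε/16`, and `6R log y + log(1/δ) ≤ nε/4` by the constant 24. The
    -- total `7nε/16` is below `nε/2 ≤ n log(1+ε)`.
    rw [h10]
    linarith
  rw [← Real.log_le_log_iff (by positivity) (by positivity),
    Real.log_mul (by positivity) (by positivity), Real.log_pow, Real.log_pow]
  push_cast
  exact hmain

/-! ### Sample probabilities and the learning guarantee -/

theorem sampleProb_eq_one {α : Type*} {T : Finset α} (hT : T.Nonempty) (n : ℕ)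
    {E : List α → Prop} (hE : ∀ s, E s) : sampleProb T n E = 1 := by
  have hpos : (0 : ℝ) < (T.card : ℝ) ^ n := by
    have := hT.card_pos
    positivity
  rw [sampleProb, div_eq_one_iff_eq hpos.ne']
  simp [hE, Nat.card_eq_fintype_card]

theorem le_sampleProb {α : Type*} {T : Finset α} (hT : T.Nonempty) {n : ℕ}
    {E : List α → Prop} {δ : ℝ} (bad : Finset (Fin n → T))
    (hbad : ∀ x : Fin n → T, x ∉ bad → E (List.ofFn fun t => (x t : α)))
    (hcard : (bad.card : ℝ) ≤ δ * (T.card : ℝ) ^ n) : 1 - δ ≤ sampleProb T n E := by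
  classical
  have hpos : (0 : ℝ) < (T.card : ℝ) ^ n := by
    have := hT.card_pos
    positivity
  rw [sampleProb, le_div_iff₀ hpos, Nat.card_eq_fintype_card, Fintype.card_subtype]
  have h1 : (Finset.univ : Finset (Fin n → T)).card ≤
      bad.card +
        (Finset.univ.filter fun x : Fin n → T => E (List.ofFn fun t => (x t : α))).card := by
    refine le_trans (Finset.card_le_card fun x _ => ?_) (Finset.card_union_le _ _)
    by_cases hx : x ∈ bad
    · exact Finset.mem_union_left _ hx
    · exact Finset.mem_union_right _ (Finset.mem_filter.2 ⟨Finset.mem_univ x, hbad x hx⟩)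
  rw [Finset.card_univ, Fintype.card_fun, Fintype.card_coe, Fintype.card_fin] at h1
  have h2 : (T.card : ℝ) ^ n ≤ bad.card +
      (Finset.univ.filter fun x : Fin n → T => E (List.ofFn fun t => (x t : α))).card := by
    exact_mod_cast h1
  linarith

theorem agreesOn_of_forall {α β : Type*} [DecidableEq β] {T : Finset α} {ε : ℝ} (hε : 0 ≤ ε)
    {h f : α → β} (hf : ∀ p, h p = f p) : AgreesOn T ε h f := by
  have : (0 : ℝ) ≤ T.card := Nat.cast_nonneg _
  simp only [AgreesOn, hf, Finset.filter_true]
  nlinarith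

/-- A learner that is consistent with the sample and picks its hypotheses from the all-pairs
votes of halfspaces agrees with the labeling with high probability. -/
theorem le_sampleProb_agreesOn {α : Type*} {k r n : ℕ} (hr : 1 ≤ r)
    (sel : (Fin k → ℤ) → Fin k) (φ : α → EuclideanSpace ℝ (Fin r)) (f : α → Fin k)
    {A : List α → α → Fin k}
    (hA : ∀ s, ∃ g : Fin k → Fin k → EuclideanSpace ℝ (Fin r) → ℤ,
      (∀ a b, a ≠ b → g a b ∈ halfspaceClass r) ∧ ∀ p, A s p = allPairsVote sel g (φ p))
    (hcons : ∀ s, ∀ p ∈ s, A s p = f p) {T : Finset α} (hT : T.Nonempty) {ε δ : ℝ}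
    (hε : 0 ≤ ε) (hn : (2 * n + 1 : ℝ) ^ ((r + 1) * k ^ 2) ≤ δ * (1 + ε) ^ n) :
    1 - δ ≤ sampleProb T n fun s => AgreesOn T ε (A s) f := by
  classical
  let 𝓔 : Finset (Finset T) := Finset.univ.filter fun E =>
    ∃ g : Fin k → Fin k → EuclideanSpace ℝ (Fin r) → ℤ,
      (∀ a b, a ≠ b → g a b ∈ halfspaceClass r) ∧
        ∀ t : T, t ∈ E ↔ allPairsVote sel g (φ t) ≠ f t
  let bad : Finset (Fin n → T) := Finset.univ.filter fun x =>
    ¬ AgreesOn T ε (A (List.ofFn fun t => (x t : α))) f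
  have hG (W : Finset T) (hW : W.card ≤ 2 * n) :
      (𝓔.image (· ∩ W)).card ≤ (2 * n + 1) ^ ((r + 1) * k ^ 2) := by
    refine (card_image_inter_errorSets_le sel (fun t : T => φ t) (fun t => f t)
      (fun E hE => (Finset.mem_filter.1 hE).2) (halfspaceClass_nonempty hr) W).trans ?_
    gcongr
  have hbad : ∀ x ∈ bad, ∃ E ∈ 𝓔, (∀ i, x i ∉ E) ∧ ε * Fintype.card T ≤ E.card := by
    intro x hx
    set s := List.ofFn fun t => (x t : α) with hs
    obtain ⟨g, hg, hgA⟩ := hA s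
    refine ⟨Finset.univ.filter fun t : T => A s t ≠ f t, ?_, ?_, ?_⟩
    · exact Finset.mem_filter.2 ⟨Finset.mem_univ _, g, hg, fun t => by simp [hgA]⟩
    · intro i
      simp only [Finset.mem_filter, Finset.mem_univ, true_and, not_not]
      exact hcons s _ (List.mem_ofFn.2 ⟨i, rfl⟩)
    · have h1 : (T.filter fun p => A s p = f p).card + (T.filter fun p => ¬ A s p = f p).card =
          T.card := Finset.card_filter_add_card_filter_not _
      have h2 : (Finset.univ.filter fun t : T => A s t ≠ f t).card =
          (T.filter fun p => ¬ A s p = f p).card := by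
        rw [← Finset.card_map (Function.Embedding.subtype _)]
        congr 1
        ext p
        simp [and_comm]
      have h3 : ((T.filter fun p => A s p = f p).card : ℝ) < (1 - ε) * T.card :=
        not_le.1 (Finset.mem_filter.1 hx).2
      have h4 : ((T.filter fun p => A s p = f p).card : ℝ) +
          (T.filter fun p => ¬ A s p = f p).card = T.card := by exact_mod_cast h1
      rw [h2, Fintype.card_coe]
      linarith
  have hcard := card_bad_mul_le hG (by simpa using hT) hε bad hbad
  rw [Fintype.card_coe] at hcard
  refine le_sampleProb hT bad (fun x hx => ?_) ?_
  · by_contra hx'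
    exact hx (Finset.mem_filter.2 ⟨Finset.mem_univ x, hx'⟩)
  · have hpos : (0 : ℝ) < (1 + ε) ^ n := by positivity
    refine le_of_mul_le_mul_right (hcard.trans ?_) hpos
    push_cast
    calc _ ≤ δ * (1 + ε) ^ n * (T.card : ℝ) ^ n := by gcongr
      _ = _ := by ring

theorem allPairsLearner_learnsWith {k r : ℕ} (hk : 1 ≤ k) (hr : 1 ≤ r)
    {B : List (EuclideanSpace ℝ (Fin r) × ℤ) → EuclideanSpace ℝ (Fin r) → ℤ}
    {sel : (Fin k → ℤ) → Fin k} (hB : IsERM (halfspaceClass r) B) (hsel : IsArgmaxRule sel)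
    {m : Set (EuclideanSpace ℝ (Fin r)) → ℝ → ℝ → ℕ}
    (hm : ∀ Q ε δ, 24 * (((k : ℝ) ^ 2 * (r : ℝ) * Real.log ((k : ℝ) ^ 2 * (r : ℝ))
      * Real.log ((k : ℝ) ^ 3 * (r : ℝ) / ε) + Real.log (1 / δ)) / ε) ≤ m Q ε δ) :
    (allPairsLearner B sel).LearnsWith (euclideanFamily k r) m := by
  intro ε hε δ hδ I hI O hO T hT n hn
  -- For `k = 1` the factor `log (k ^ 2 * r)` can vanish, but with a single label every output is
  -- correct.
  rcases hk.eq_or_lt with rfl | hk2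
  · rw [sampleProb_eq_one hT n fun s => agreesOn_of_forall hε.1.le fun p => Subsingleton.elim _ _]
    linarith [hδ.1]
  · refine le_sampleProb_agreesOn hr sel (fun p : I.P => (p : EuclideanSpace ℝ (Fin r))) O.label
      (A := fun s => allPairsLearner B sel I (labeled O.label s)) (fun s => ?_)
      (fun s p hp => allPairsLearner_zeroSampleError hr hB hsel I hI O hO s p hp) hT hε.1.le
      (growth_le_of_le hk2 hr hε hδ ((hm _ _ _).trans (Nat.cast_le.2 hn)))
    obtain ⟨g, hg, hgA⟩ := (allPairsLearner_isAllPairsERM hr hB hsel I hI O hO s).1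
    exact ⟨g, hg, fun p => congrFun hgA p⟩

theorem mainTheorem5 :
    ∃ C : ℝ, 0 < C ∧ ∀ k r : ℕ, 1 ≤ k → 1 ≤ r →
      ∃ m : Set (EuclideanSpace ℝ (Fin r)) → ℝ → ℝ → ℕ,
        (∀ Q ε δ, 0 < m Q ε δ) ∧
        (∀ ε ∈ Set.Ioo (0 : ℝ) 1, ∀ δ ∈ Set.Ioo (0 : ℝ) 1,
          m Set.univ ε δ ≤
            ⌈C * (((k : ℝ) ^ 2 * (r : ℝ) * Real.log ((k : ℝ) ^ 2 * (r : ℝ))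
                * Real.log ((k : ℝ) ^ 3 * (r : ℝ) / ε) + Real.log (1 / δ)) / ε)⌉₊) ∧
        (∃ B : List (EuclideanSpace ℝ (Fin r) × ℤ) → EuclideanSpace ℝ (Fin r) → ℤ,
          IsERM (halfspaceClass r) B) ∧
        (∃ sel : (Fin k → ℤ) → Fin k, IsArgmaxRule sel) ∧
        ∀ (B : List (EuclideanSpace ℝ (Fin r) × ℤ) → EuclideanSpace ℝ (Fin r) → ℤ)
          (sel : (Fin k → ℤ) → Fin k),
          IsERM (halfspaceClass r) B → IsArgmaxRule sel →
            (allPairsLearner B sel).IsAllPairsERM sel (euclideanFamily k r) ∧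
            (allPairsLearner B sel).LearnsWith (euclideanFamily k r) m ∧
            (allPairsLearner B sel).ZeroSampleError (euclideanFamily k r) ∧
            (allPairsLearner B sel).NonInventive (euclideanFamily k r) := by
  -- The `max 1` secures positivity also for `ε`, `δ` outside `(0, 1)`. Inside, the ceiling is
  -- already positive because `log (1 / δ) > 0`, so the upper bound is unaffected.
  refine ⟨24, by norm_num, fun k r hk hr => ⟨fun _ ε δ => max 1
    ⌈24 * (((k : ℝ) ^ 2 * (r : ℝ) * Real.log ((k : ℝ) ^ 2 * (r : ℝ))
      * Real.log ((k : ℝ) ^ 3 * (r : ℝ) / ε) + Real.log (1 / δ)) / ε)⌉₊,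
    fun _ _ _ => lt_max_of_lt_left one_pos, fun ε hε δ hδ => max_le ?_ le_rfl,
    exists_isERM (halfspaceClass_nonempty hr), exists_isArgmaxRule hk,
    fun B sel hB hsel => ⟨allPairsLearner_isAllPairsERM hr hB hsel,
      allPairsLearner_learnsWith hk hr hB hsel fun _ ε δ =>
        (Nat.le_ceil _).trans (Nat.cast_le.2 (le_max_right _ _)),
      allPairsLearner_zeroSampleError hr hB hsel, allPairsLearner_nonInventive hB hsel⟩⟩⟩
  have hk' : (1 : ℝ) ≤ k := by exact_mod_cast hk
  have hr' : (1 : ℝ) ≤ r := by exact_mod_cast hr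
  have h1 : 0 ≤ Real.log ((k : ℝ) ^ 2 * r) :=
    Real.log_nonneg (one_le_mul_of_one_le_of_one_le (one_le_pow₀ hk') hr')
  have h2 : 0 ≤ Real.log ((k : ℝ) ^ 3 * r / ε) := by
    refine Real.log_nonneg ?_
    rw [le_div_iff₀ hε.1]
    have := one_le_mul_of_one_le_of_one_le (one_le_pow₀ hk' (n := 3)) hr'
    linarith [hε.2]
  have h3 : 0 < Real.log (1 / δ) :=
    Real.log_pos (by rw [lt_div_iff₀ hδ.1]; linarith [hδ.2])
  have := hε.1
  exact Nat.one_le_iff_ne_zero.2 (Nat.ceil_pos.2 (by positivity)).ne'
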